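/- For a probability measure $\alpha$ on $\mathbb{R}$ write $\alpha\in FT_1$ if $\int_{\mathbb{R}}\log(1+|x|)\,\alpha(dx)<\infty$. For $\alpha\in FT_1$ let $\mu(\alpha)$ be the distribution of $X=\sum_{i\ge 1}W_iB_i$ (the series converges absolutely almost surely), where $B_1,Y_1,B_2,Y_2,\dots$ are independent random variables, $B_i\sim\alpha$, $Y_i$ is uniform on $(0,1)$ (that is, $Y_i\sim\beta(1,1)$), and $W_i=Y_i\prod_{l<i}(1-Y_l)$; equivalently, $X=\int x\,P(dx)$ is the mean of a Dirichlet random probability $P$ with parameter $\alpha$. Put $\mu_0(\alpha)=\alpha$ and $\mu_k(\alpha)=\mu(\mu_{k-1}(\alpha))$, defined as long as $\mu_{k-1}(\alpha)\in FT_1$. Let $n\ge 2$ be an integer. Suppose that $\mu_k(\alpha)\in FT_1$ for $k=0,1,\dots,n-1$ and that $\mu_n(\alpha)=\alpha$. For $1\le j\le n$ and $\operatorname{Im} z>0$ let $$y_j(z)=\int_{\mathbb{R}}\frac{\mu_j(\alpha)(dw)}{w-z}.$$ Then the functions $y_j$ are holomorphic on $\{\operatorname{Im} z>0\}$ and there satisfy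 the cyclic system $$y_1'=y_n\,y_1,\qquad y_j'=y_{j-1}\,y_j\quad(2\le j\le n).$$ Moreover, if $n=2$, then $\alpha$ is a Cauchy distribution $\frac1\pi\frac{b\,dx}{(x-a)^2+b^2}$ with $a\in\mathbb{R}$, $b>0$, or a Dirac mass $\delta_a$ with $a\in\mathbb{R}$. -/

import Mathlib

open MeasureTheory ProbabilityTheory

/-- The class `FT₁` of probability measures `α` on `ℝ` with `∫ log (1 + |x|) α(dx) < ∞`. -/
structure IsFT1 (α : Measure ℝ) : Prop where
  isProbabilityMeasure : IsProbabilityMeasure α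
  integrable_log : Integrable (fun x : ℝ => Real.log (1 + |x|)) α

/-- The law of the sequence `((Bₙ, Yₙ))ₙ` where all the `Bₙ ∼ α` and `Yₙ ∼ β(1, t)` are
independent. -/
noncomputable def stickLaw (t : ℝ) (α : Measure ℝ) : Measure (ℕ → ℝ × ℝ) :=
  Measure.infinitePi fun _ => α.prod (betaMeasure 1 t)

/-- The stick-breaking weights `Wₙ = Yₙ (1 - Yₙ₋₁) ⋯ (1 - Y₀)` (indices start at `0`). -/
def stickWeight (ω : ℕ → ℝ × ℝ) (n : ℕ) : ℝ :=
  (ω n).2 * ∏ i ∈ Finset.range n, (1 - (ω i).2)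

/-- The random mean `X = ∑ₙ Wₙ Bₙ = ∫ x P(dx)` of the Dirichlet random probability
`P = ∑ₙ Wₙ δ_{Bₙ}`. -/
noncomputable def stickMean (ω : ℕ → ℝ × ℝ) : ℝ :=
  ∑' n, stickWeight ω n * (ω n).1

/-- `μ(tα)`: the distribution of the mean of a Dirichlet random probability with governing
probability `α` and intensity `t`. It is meaningful for `0 < t` and `α` in `FT₁`, in which case
the series defining the mean converges absolutely almost surely. -/
noncomputable def dirichletMean (t : ℝ) (α : Measure ℝ) : Measure ℝ :=
  (stickLaw t α).map stickMean

/-- The iterates `μ₀(α) = α`, `μ_{k+1}(α) = μ(μ_k(α))`, where `μ(α) = μ(1·α)`. -/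
noncomputable def dirichletIter (α : Measure ℝ) : ℕ → Measure ℝ
  | 0 => α
  | k + 1 => dirichletMean 1 (dirichletIter α k)

/-- The Stieltjes transform `z ↦ ∫ α(dw) / (w - z)`, considered for `Im z > 0`. -/
noncomputable def stieltjesTransform (α : Measure ℝ) (z : ℂ) : ℂ :=
  resolventTransform α z

theorem stieltjesTransform_eq (α : Measure ℝ) (z : ℂ) :
    stieltjesTransform α z = ∫ w : ℝ, 1 / ((w : ℂ) - z) ∂α := by
  simp [stieltjesTransform, resolventTransform_apply, resolvent]

theorem measurable_stickMean : Measurable stickMean := by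
  unfold stickMean stickWeight
  exact Measurable.tsum fun n => by fun_prop

theorem isProbabilityMeasure_dirichletMean {t : ℝ} (ht : 0 < t) (α : Measure ℝ)
    [IsProbabilityMeasure α] : IsProbabilityMeasure (dirichletMean t α) := by
  have : IsProbabilityMeasure (betaMeasure 1 t) := isProbabilityMeasureBeta one_pos ht
  have : IsProbabilityMeasure (stickLaw t α) := by unfold stickLaw; infer_instance
  exact Measure.isProbabilityMeasure_map measurable_stickMean.aemeasurable

open Filter Topology Set
open scoped ENNReal BoundedContinuousFunction

/-! Splitting off the first stick gives `X ∼ Y B + (1 - Y) X` with `Y` uniform and `B ∼ α`, all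
independent (`map_dirichletMean_eq`). For fixed `b`, `x` the uniform average of `(y b + (1 - y) x -
z)⁻²` is `(b - z)⁻¹ (x - z)⁻¹`. Integrating over `b` and `x` shows that the derivative of the
Stieltjes transform of `μ(α)` is the product of the transforms of `α` and `μ(α)`. Iterating around
the cycle gives the system. For `n = 2` both transforms have the same derivative, so they differ by
a constant, which vanishes by decay along the imaginary axis. The common transform solves `y' = y²`,
hence `y = 1 / (c - z)` with `Im c ≤ 0`, and Stieltjes inversion
(`eq_cauchyMeasure_of_integral_inv`) identifies `α`: Cauchy, or Dirac when `c` is real. -/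

theorem betaMeasure_one_one : betaMeasure 1 1 = volume.restrict (Ioo (0 : ℝ) 1) := by
  rw [betaMeasure, ← withDensity_indicator_one measurableSet_Ioo]
  congr 1
  ext x
  by_cases hx : 0 < x ∧ x < 1
  · rw [betaPDF_eq, if_pos hx, indicator_of_mem (show x ∈ Ioo (0 : ℝ) 1 from hx)]
    simp [beta, one_add_one_eq_two]
  · rw [betaPDF_eq, if_neg hx, indicator_of_notMem (show x ∉ Ioo (0 : ℝ) 1 from hx)]
    simp

instance isProbabilityMeasure_betaMeasure_one_one : IsProbabilityMeasure (betaMeasure 1 1) :=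
  isProbabilityMeasureBeta one_pos one_pos

theorem lintegral_one_sub_betaMeasure_one_one :
    ∫⁻ y, ENNReal.ofReal (1 - y) ∂betaMeasure 1 1 = 2⁻¹ := by
  rw [betaMeasure_one_one, restrict_Ioo_eq_restrict_Ioc, ← ofReal_integral_eq_lintegral_ofReal]
  · rw [← intervalIntegral.integral_of_le zero_le_one]
    have h := intervalIntegral.integral_comp_sub_left (a := 0) (b := 1) (fun x : ℝ => x) 1
    rw [h, integral_id]
    norm_num
    rw [ENNReal.ofReal_div_of_pos two_pos]
    simp
  · exact (Continuous.integrableOn_Ioc (by fun_prop))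
  · filter_upwards [ae_restrict_mem measurableSet_Ioc] with y hy
    simpa using hy.2

/-! ### Shift structure of an i.i.d. sequence -/

/-- Prepend a value to a sequence. -/
def seqCons {X : Type*} (p : X × (ℕ → X)) : ℕ → X
  | 0 => p.1
  | n + 1 => p.2 n

theorem measurable_seqCons {X : Type*} [MeasurableSpace X] :
    Measurable (seqCons : X × (ℕ → X) → ℕ → X) := by
  refine measurable_pi_lambda _ fun n => ?_
  cases n with
  | zero => exact measurable_fst
  | succ n => exact (measurable_pi_apply n).comp measurable_snd

/-- Checked on finite boxes: coordinate 0 splits off and the other indices shift down by one. This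
is what makes the stick-breaking recursion an identity in law. -/
theorem map_seqCons_prod_infinitePi {X : Type*} [MeasurableSpace X] (ν : Measure X)
    [IsProbabilityMeasure ν] :
    (ν.prod (Measure.infinitePi fun _ : ℕ => ν)).map seqCons =
      Measure.infinitePi fun _ : ℕ => ν := by
  classical
  refine Measure.eq_infinitePi _ fun s t ht => ?_
  rw [Measure.map_apply measurable_seqCons (.pi s.countable_toSet fun i _ => ht i)]
  set s' : Finset ℕ := s.preimage Nat.succ (Nat.succ_injective.injOn) with hs'
  have hpre : seqCons ⁻¹' (s : Set ℕ).pi t =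
      (if 0 ∈ s then t 0 else univ) ×ˢ (s' : Set ℕ).pi (fun i => t (i + 1)) := by
    ext ⟨p, ω⟩
    simp only [mem_preimage, Set.mem_pi, Finset.mem_coe, mem_prod, hs', Finset.mem_preimage]
    constructor
    · intro h
      refine ⟨?_, fun i hi => h (i + 1) hi⟩
      split_ifs with h0
      · exact h 0 h0
      · trivial
    · rintro ⟨h0, h1⟩ i hi
      cases i with
      | zero => exact (by simpa [show 0 ∈ s from hi] using h0 : p ∈ t 0)
      | succ i => exact h1 i hi
  rw [hpre, Measure.prod_prod, Measure.infinitePi_pi _ fun i _ => ht _]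
  have himg : ∏ i ∈ s', ν (t (i + 1)) = ∏ i ∈ s.erase 0, ν (t i) := by
    refine Finset.prod_bij (fun i _ => i + 1) ?_ ?_ ?_ ?_
    · intro i hi
      simpa [hs'] using hi
    · intro i _ j _ h
      simpa using h
    · intro i hi
      rw [Finset.mem_erase] at hi
      obtain ⟨k, rfl⟩ := Nat.exists_eq_succ_of_ne_zero hi.1
      exact ⟨k, by simpa [hs'] using hi.2, rfl⟩
    · intro i _
      rfl
  rw [himg]
  split_ifs with h0
  · exact Finset.mul_prod_erase s (fun i => ν (t i)) h0
  · rw [Finset.erase_eq_of_notMem h0]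
    simp

/-! ### Convergence of the stick-breaking series and its fixed-point equation -/

section StickBreaking

variable {α : Measure ℝ}

theorem lintegral_prod_one_sub_stickLaw [IsProbabilityMeasure α] (n : ℕ) :
    ∫⁻ ω, ∏ i ∈ Finset.range n, ENNReal.ofReal (1 - (ω i).2) ∂stickLaw 1 α = 2⁻¹ ^ n := by
  induction n with
  | zero =>
    have : IsProbabilityMeasure (stickLaw 1 α) := by unfold stickLaw; infer_instance
    simp
  | succ n ih =>
    rw [stickLaw] at ih ⊢
    rw [← map_seqCons_prod_infinitePi, lintegral_map (by fun_prop) measurable_seqCons]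
    simp only [Finset.prod_range_succ', seqCons]
    have hm : Measurable fun ω : ℕ → ℝ × ℝ =>
        ∏ i ∈ Finset.range n, ENNReal.ofReal (1 - (ω i).2) := by fun_prop
    have hm' : Measurable fun p : ℝ × ℝ => ENNReal.ofReal (1 - p.2) := by fun_prop
    simp_rw [mul_comm (∏ i ∈ Finset.range n, _)]
    rw [lintegral_prod_mul hm'.aemeasurable hm.aemeasurable, ih, pow_succ']
    congr 1
    rw [← lintegral_one_sub_betaMeasure_one_one, lintegral_prod _ (by fun_prop)]
    simp

/-- Borel–Cantelli: integrability of the logarithm makes the tail probabilities at `n log (3/2)`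
summable. Any ratio in `(1, 2)` would do, since the remaining stick has mean `2⁻ⁿ`. -/
theorem ae_stickLaw_fst_le (hα : IsFT1 α) :
    ∀ᵐ ω ∂stickLaw 1 α, ∀ᶠ n : ℕ in atTop, |(ω n).1| ≤ (3 / 2 : ℝ) ^ n := by
  have := hα.isProbabilityMeasure
  set c : ℝ := Real.log (3 / 2) with hc
  have hc0 : 0 < c := Real.log_pos (by norm_num)
  have hlog : ∀ x : ℝ, 0 ≤ Real.log (1 + |x|) := fun x => Real.log_nonneg (by simp)
  -- `tsum_prob_mem_Ioi_lt_top` is stated for the ambient volume, so `α` is installed as the volume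
  -- here.
  let _ : MeasureSpace ℝ := ⟨α⟩
  have hsum := tsum_prob_mem_Ioi_lt_top (Ω := ℝ) (X := fun x : ℝ => Real.log (1 + |x|) / c)
    (hα.integrable_log.div_const c) (fun x => div_nonneg (hlog x) hc0.le)
  have hmeas : ∀ n : ℕ, MeasurableSet {x : ℝ | Real.log (1 + |x|) / c ∈ Ioi (n : ℝ)} := fun n =>
    measurableSet_preimage (by fun_prop) measurableSet_Ioi
  have hBC := measure_limsup_atTop_eq_zero (μ := stickLaw 1 α)
    (s := fun n : ℕ => {ω | Real.log (1 + |(ω n).1|) / c ∈ Ioi (n : ℝ)}) (by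
      refine ne_of_lt (lt_of_le_of_lt (ENNReal.tsum_le_tsum fun n => ?_) hsum)
      have hmap : ((stickLaw 1 α).map fun ω => ω n).map Prod.fst = α := by
        rw [stickLaw, Measure.infinitePi_map_eval, ← Measure.fst, Measure.fst_prod]
      change _ ≤ α _
      rw [Measure.map_map measurable_fst (measurable_pi_apply n)] at hmap
      refine le_of_eq ((Measure.map_apply (measurable_fst.comp (measurable_pi_apply n))
        (hmeas n)).symm.trans ?_)
      rw [hmap])
  have hae := measure_eq_zero_iff_ae_notMem.1 hBC
  filter_upwards [hae] with ω hω
  rw [mem_limsup_iff_frequently_mem, not_frequently] at hω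
  filter_upwards [hω] with n hn
  simp only [mem_Ioi, not_lt] at hn
  rw [div_le_iff₀ hc0, hc, ← Real.log_pow] at hn
  have := (Real.log_le_log_iff (by positivity) (by positivity)).1 hn
  linarith

theorem ae_stickLaw_snd_mem [IsProbabilityMeasure α] :
    ∀ᵐ ω ∂stickLaw 1 α, ∀ n : ℕ, (ω n).2 ∈ Ioo (0 : ℝ) 1 := by
  rw [ae_all_iff]
  intro n
  have hmap : ((stickLaw 1 α).map fun ω => ω n).map Prod.snd = betaMeasure 1 1 := by
    rw [stickLaw, Measure.infinitePi_map_eval, ← Measure.snd, Measure.snd_prod]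
  have h : ∀ᵐ y ∂betaMeasure 1 1, y ∈ Ioo (0 : ℝ) 1 := by
    rw [betaMeasure_one_one]
    exact ae_restrict_mem measurableSet_Ioo
  rw [← hmap, Measure.map_map measurable_snd (measurable_pi_apply n)] at h
  exact ae_of_ae_map (measurable_snd.comp (measurable_pi_apply n)).aemeasurable h

/-- The terms are eventually dominated by `(3/2)ⁿ` times the remaining stick, whose expectations
`(3/4)ⁿ` are summable. -/
theorem ae_summable_stickLaw (hα : IsFT1 α) :
    ∀ᵐ ω ∂stickLaw 1 α, Summable fun n => stickWeight ω n * (ω n).1 := by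
  have := hα.isProbabilityMeasure
  have hmeas (n : ℕ) : Measurable fun ω : ℕ → ℝ × ℝ => ENNReal.ofReal ((3 / 2) ^ n) *
      ∏ i ∈ Finset.range n, ENNReal.ofReal (1 - (ω i).2) := by fun_prop
  have hfin : ∫⁻ ω, ∑' n : ℕ, ENNReal.ofReal ((3 / 2) ^ n) *
      ∏ i ∈ Finset.range n, ENNReal.ofReal (1 - (ω i).2) ∂stickLaw 1 α ≠ ∞ := by
    rw [lintegral_tsum fun n => (hmeas n).aemeasurable]
    simp_rw [lintegral_const_mul' _ _ ENNReal.ofReal_ne_top, lintegral_prod_one_sub_stickLaw]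
    have h (n : ℕ) : ENNReal.ofReal ((3 / 2) ^ n) * 2⁻¹ ^ n = ENNReal.ofReal ((3 / 4) ^ n) := by
      have h2 : (2⁻¹ : ℝ≥0∞) = ENNReal.ofReal 2⁻¹ := by
        rw [ENNReal.ofReal_inv_of_pos two_pos]; simp
      rw [h2, ← ENNReal.ofReal_pow (by norm_num), ← ENNReal.ofReal_mul (by positivity), ← mul_pow]
      norm_num
    simp_rw [h]
    exact (summable_geometric_of_lt_one (by norm_num) (by norm_num)).tsum_ofReal_ne_top
  filter_upwards [ae_lt_top (Measurable.tsum hmeas) hfin, ae_stickLaw_fst_le hα, ae_stickLaw_snd_mem]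
    with ω hω hB hY
  have hnn : ∀ i, 0 ≤ 1 - (ω i).2 := fun i => by linarith [(hY i).2]
  have hsum : Summable fun n : ℕ => (3 / 2 : ℝ) ^ n * ∏ i ∈ Finset.range n, (1 - (ω i).2) := by
    have := ENNReal.summable_toReal hω.ne
    refine this.congr fun n => ?_
    rw [← ENNReal.ofReal_prod_of_nonneg fun i _ => hnn i, ← ENNReal.ofReal_mul (by positivity),
      ENNReal.toReal_ofReal (mul_nonneg (by positivity) (Finset.prod_nonneg fun i _ => hnn i))]
  refine hsum.of_norm_bounded_eventually_nat ?_
  filter_upwards [hB] with n hn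
  have hP : 0 ≤ ∏ i ∈ Finset.range n, (1 - (ω i).2) := Finset.prod_nonneg fun i _ => hnn i
  rw [stickWeight, norm_mul, norm_mul, Real.norm_of_nonneg hP, Real.norm_of_nonneg (hY n).1.le,
    Real.norm_eq_abs, mul_comm]
  refine mul_le_mul hn ?_ (mul_nonneg (hY n).1.le hP) (by positivity)
  exact mul_le_of_le_one_left hP (hY n).2.le

theorem stickMean_seqCons (p : ℝ × ℝ) {ω : ℕ → ℝ × ℝ}
    (hω : Summable fun n => stickWeight ω n * (ω n).1) :
    stickMean (seqCons (p, ω)) = p.2 * p.1 + (1 - p.2) * stickMean ω := by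
  have hshift (n : ℕ) : stickWeight (seqCons (p, ω)) (n + 1) * (seqCons (p, ω) (n + 1)).1 =
      (1 - p.2) * (stickWeight ω n * (ω n).1) := by
    simp only [stickWeight, seqCons, Finset.prod_range_succ']
    ring
  rw [stickMean, Summable.tsum_eq_zero_add]
  · simp_rw [hshift, tsum_mul_left]
    simp [stickWeight, seqCons, stickMean]
  · rw [← summable_nat_add_iff 1]
    simp_rw [hshift]
    exact hω.mul_left _

/-- The distributional identity `X ∼ Y B + (1 - Y) X`. -/
theorem map_dirichletMean_eq (hα : IsFT1 α) :
    ((α.prod (betaMeasure 1 1)).prod (dirichletMean 1 α)).map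
      (fun q => q.1.2 * q.1.1 + (1 - q.1.2) * q.2) = dirichletMean 1 α := by
  have := hα.isProbabilityMeasure
  have : IsProbabilityMeasure (stickLaw 1 α) := by unfold stickLaw; infer_instance
  conv_rhs => rw [dirichletMean, stickLaw, ← map_seqCons_prod_infinitePi,
    Measure.map_map measurable_stickMean measurable_seqCons, ← stickLaw]
  have hprod : (α.prod (betaMeasure 1 1)).prod (dirichletMean 1 α) =
      ((α.prod (betaMeasure 1 1)).prod (stickLaw 1 α)).map (Prod.map id stickMean) := by
    rw [dirichletMean, ← Measure.map_prod_map _ _ measurable_id measurable_stickMean,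
      Measure.map_id]
  rw [hprod, Measure.map_map (by fun_prop) (measurable_id.prodMap measurable_stickMean)]
  refine Measure.map_congr ?_
  have hs := Measure.quasiMeasurePreserving_snd (μ := α.prod (betaMeasure 1 1))
    (ν := stickLaw 1 α) |>.ae (ae_summable_stickLaw hα)
  filter_upwards [hs] with q hq
  exact (stickMean_seqCons q.1 hq).symm

end StickBreaking

/-! ### The differential equation for the Stieltjes transform -/

theorem resolvent_ofReal (z : ℂ) (x : ℝ) : resolvent z x = ((x : ℂ) - z)⁻¹ := by
  simp [resolvent]

theorem ofReal_sub_ne_zero {z : ℂ} (hz : 0 < z.im) (x : ℝ) : (x : ℂ) - z ≠ 0 := by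
  intro h
  have := congrArg Complex.im h
  simp at this
  exact hz.ne' this

theorem norm_ofReal_sub_inv_le {z : ℂ} (hz : 0 < z.im) (x : ℝ) :
    ‖((x : ℂ) - z)⁻¹‖ ≤ z.im⁻¹ := by
  rw [norm_inv]
  refine inv_anti₀ hz ?_
  have := Complex.abs_im_le_norm ((x : ℂ) - z)
  simpa [abs_of_pos hz] using this

theorem integrable_ofReal_sub_inv (μ : Measure ℝ) [IsFiniteMeasure μ] {z : ℂ} (hz : 0 < z.im) :
    Integrable (fun x : ℝ => ((x : ℂ) - z)⁻¹) μ :=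
  Integrable.of_bound (by fun_prop) z.im⁻¹ (ae_of_all _ (norm_ofReal_sub_inv_le hz))

theorem stieltjesTransform_eq_inv (μ : Measure ℝ) (z : ℂ) :
    stieltjesTransform μ z = ∫ x : ℝ, ((x : ℂ) - z)⁻¹ ∂μ := by
  simp [stieltjesTransform_eq]

theorem hasDerivAt_stieltjesTransform (μ : Measure ℝ) [IsFiniteMeasure μ] {z : ℂ}
    (hz : 0 < z.im) :
    HasDerivAt (stieltjesTransform μ) (∫ x : ℝ, ((x : ℂ) - z)⁻¹ ^ 2 ∂μ) z := by
  have h := hasDerivAt_resolventTransform (μ := μ) z (by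
    rintro ⟨x, -, hx⟩
    exact ofReal_sub_ne_zero hz x (sub_eq_zero.2 hx))
  simp_rw [resolvent_ofReal] at h
  exact h

theorem integral_betaMeasure_one_one_inv_sq {z : ℂ} (hz : 0 < z.im) (b x : ℝ) :
    ∫ y, (((y * b + (1 - y) * x : ℝ) : ℂ) - z)⁻¹ ^ 2 ∂betaMeasure 1 1 =
      ((x : ℂ) - z)⁻¹ * ((b : ℂ) - z)⁻¹ := by
  rw [betaMeasure_one_one, restrict_Ioo_eq_restrict_Ioc,
    ← intervalIntegral.integral_of_le zero_le_one]
  have hD (y : ℝ) := ofReal_sub_ne_zero hz (y * b + (1 - y) * x)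
  have hx := ofReal_sub_ne_zero hz x
  have hb := ofReal_sub_ne_zero hz b
  -- This antiderivative, normalised to vanish at `y = 0`, has no division by `b - x`, so `b = x` is
  -- not a separate case.
  have hderiv (y : ℝ) : HasDerivAt
      (fun y : ℝ => (y : ℂ) / (((x : ℂ) - z) * (((y * b + (1 - y) * x : ℝ) : ℂ) - z)))
      ((((y * b + (1 - y) * x : ℝ) : ℂ) - z)⁻¹ ^ 2) y := by
    have h1 : HasDerivAt (fun y : ℝ => (y : ℂ)) 1 y := Complex.ofRealCLM.hasDerivAt
    have h2 : HasDerivAt (fun y : ℝ => y * b + (1 - y) * x) (b - x) y := by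
      have := ((hasDerivAt_id y).mul_const b).add
        (((hasDerivAt_id y).const_sub 1).mul_const x)
      exact this.congr_deriv (by ring)
    have h3 := ((h2.ofReal_comp.sub_const z).const_mul ((x : ℂ) - z))
    convert! h1.div h3 (mul_ne_zero hx (hD y)) using 1
    have := hD y
    field_simp
    push_cast
    ring
  rw [intervalIntegral.integral_eq_sub_of_hasDerivAt (fun y _ => hderiv y)]
  · simp [mul_comm]
  · refine Continuous.intervalIntegrable ?_ _ _
    exact (Continuous.inv₀ (by fun_prop) hD).pow 2

theorem integral_inv_sq_dirichletMean {α : Measure ℝ} (hα : IsFT1 α) {z : ℂ} (hz : 0 < z.im) :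
    ∫ x : ℝ, ((x : ℂ) - z)⁻¹ ^ 2 ∂dirichletMean 1 α =
      stieltjesTransform α z * stieltjesTransform (dirichletMean 1 α) z := by
  have := hα.isProbabilityMeasure
  have := isProbabilityMeasure_dirichletMean one_pos α
  have hbound (x : ℝ) : ‖((x : ℂ) - z)⁻¹ ^ 2‖ ≤ z.im⁻¹ ^ 2 := by
    rw [norm_pow]
    exact pow_le_pow_left₀ (norm_nonneg _) (norm_ofReal_sub_inv_le hz x) 2
  conv_lhs => rw [← map_dirichletMean_eq hα]
  rw [integral_map (by fun_prop) (by fun_prop), integral_prod_symm]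
  · have hinner (x : ℝ) : ∫ p : ℝ × ℝ, (((p.2 * p.1 + (1 - p.2) * x : ℝ) : ℂ) - z)⁻¹ ^ 2
        ∂α.prod (betaMeasure 1 1) = stieltjesTransform α z * ((x : ℂ) - z)⁻¹ := by
      rw [integral_prod]
      · simp_rw [integral_betaMeasure_one_one_inv_sq hz, integral_const_mul,
          ← stieltjesTransform_eq_inv, mul_comm]
      · exact Integrable.of_bound (by fun_prop) (z.im⁻¹ ^ 2) (ae_of_all _ fun _ => hbound _)
    simp_rw [hinner, integral_const_mul, ← stieltjesTransform_eq_inv]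
  · exact Integrable.of_bound (by fun_prop) (z.im⁻¹ ^ 2) (ae_of_all _ fun _ => hbound _)

theorem hasDerivAt_stieltjesTransform_dirichletMean {α : Measure ℝ} (hα : IsFT1 α) {z : ℂ}
    (hz : 0 < z.im) :
    HasDerivAt (stieltjesTransform (dirichletMean 1 α))
      (stieltjesTransform α z * stieltjesTransform (dirichletMean 1 α) z) z := by
  have := hα.isProbabilityMeasure
  have := isProbabilityMeasure_dirichletMean one_pos α
  rw [← integral_inv_sq_dirichletMean hα hz]
  exact hasDerivAt_stieltjesTransform _ hz

/-! ### Stieltjes inversion for Cauchy laws -/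

/-- Moves the parameters from the measure into the integrand, so that limits in the scale follow by
dominated convergence, including scale 0, the Dirac mass. -/
theorem lintegral_cauchyMeasure (a : ℝ) (b : NNReal) {f : ℝ → ℝ≥0∞} (hf : Measurable f) :
    ∫⁻ u, f u ∂cauchyMeasure a b = ∫⁻ s, f (a + b * s) ∂cauchyMeasure 0 1 := by
  by_cases hb : b = 0
  · subst hb
    simp
  have hb' : (0 : ℝ) < b := NNReal.coe_pos.2 (pos_iff_ne_zero.2 hb)
  rw [cauchyMeasure_of_scale_ne_zero _ hb, cauchyMeasure_of_scale_ne_zero _ one_ne_zero,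
    lintegral_withDensity_eq_lintegral_mul _ (measurable_cauchyPDF _ _) hf,
    lintegral_withDensity_eq_lintegral_mul _ (measurable_cauchyPDF _ _) (by fun_prop)]
  have hcov := lintegral_image_eq_lintegral_abs_deriv_mul (s := univ)
    (f := fun s : ℝ => a + b * s) (f' := fun _ => (b : ℝ)) MeasurableSet.univ
    (fun s _ => by
      simpa only [mul_one, id] using
        (((hasDerivAt_id s).const_mul (b : ℝ)).const_add a).hasDerivWithinAt)
    (fun s _ t _ h => by simpa [hb] using h)
    (cauchyPDF a b * f)
  have himg : (fun s : ℝ => a + b * s) '' univ = univ := by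
    refine eq_univ_of_forall fun u => ⟨(u - a) / b, trivial, ?_⟩
    field_simp
    ring
  rw [himg, setLIntegral_univ, setLIntegral_univ] at hcov
  rw [hcov]
  refine lintegral_congr fun s => ?_
  simp only [Pi.mul_apply]
  rw [← mul_assoc]
  congr 1
  rw [cauchyPDF, cauchyPDF, ← ENNReal.ofReal_mul (abs_nonneg _), abs_of_pos hb']
  congr 1
  simp only [cauchyPDFReal, NNReal.coe_one]
  field_simp
  ring_nf

theorem tendsto_lintegral_cauchyMeasure (f : ℝ →ᵇ NNReal) (a : ℝ) {b : ℕ → NNReal} {c : NNReal}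
    (hb : Tendsto b atTop (𝓝 c)) :
    Tendsto (fun n => ∫⁻ u, f u ∂cauchyMeasure a (b n)) atTop
      (𝓝 (∫⁻ u, f u ∂cauchyMeasure a c)) := by
  have hf : Measurable fun u => (f u : ℝ≥0∞) := by
    exact measurable_coe_nnreal_ennreal.comp f.continuous.measurable
  simp_rw [lintegral_cauchyMeasure _ _ hf]
  refine tendsto_lintegral_of_dominated_convergence (fun _ => (nndist f 0 : ℝ≥0∞))
    (fun n => hf.comp (by fun_prop)) (fun n => ae_of_all _ fun s => ?_) (by simp)
    (ae_of_all _ fun s => ?_)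
  · exact ENNReal.coe_le_coe.2 (BoundedContinuousFunction.NNReal.upper_bound f _)
  · refine ENNReal.tendsto_coe.2 (((f.continuous.tendsto _).comp ?_))
    have hb' : Tendsto (fun n => (b n : ℝ)) atTop (𝓝 c) :=
      (NNReal.continuous_coe.tendsto c).comp hb
    exact (hb'.mul_const s).const_add a

theorem cauchyPDFReal_eq_im (x u : ℝ) (ε : NNReal) :
    cauchyPDFReal x ε u = Real.pi⁻¹ * (((x : ℂ) - (u + ε * Complex.I))⁻¹).im := by
  have h : (x : ℂ) - (u + ε * Complex.I) = ⟨x - u, -ε⟩ := by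
    apply Complex.ext <;> simp
  rw [h, Complex.inv_im, Complex.normSq_mk, cauchyPDFReal]
  simp only [neg_neg, div_eq_mul_inv]
  ring_nf

/-- A probability measure whose Stieltjes transform on the upper half-plane is
`z ↦ 1 / (a - i b - z)` is the Cauchy distribution with parameters `a`, `b`. -/
theorem eq_cauchyMeasure_of_integral_inv {α : Measure ℝ} [IsProbabilityMeasure α] {a : ℝ}
    {b : NNReal}
    (h : ∀ z : ℂ, 0 < z.im → Integrable (fun x : ℝ => ((x : ℂ) - z)⁻¹) α ∧
      ∫ x : ℝ, ((x : ℂ) - z)⁻¹ ∂α = ((a : ℂ) - b * Complex.I - z)⁻¹) :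
    α = cauchyMeasure a b := by
  -- Imaginary part of the hypothesis at `z = u + iε`: mixing Cauchy densities of scale `ε` over
  -- centres `x ∼ α` gives a Cauchy density of scale `b + ε`.
  have hdens (ε : NNReal) (hε : 0 < ε) (u : ℝ) :
      ∫⁻ x, cauchyPDF x ε u ∂α = cauchyPDF a (b + ε) u := by
    obtain ⟨hi, he⟩ := h (u + ε * Complex.I) (by simpa using hε)
    simp_rw [cauchyPDF]
    have hint : Integrable (fun x => cauchyPDFReal x ε u) α := by
      simp_rw [cauchyPDFReal_eq_im]
      exact hi.im.const_mul _
    rw [← ofReal_integral_eq_lintegral_ofReal hint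
      (ae_of_all _ fun x => (cauchyPDF_pos x hε.ne' u).le)]
    congr 1
    simp_rw [cauchyPDFReal_eq_im, integral_const_mul]
    congr 1
    have him := integral_im hi
    simp only [RCLike.im_to_complex] at him
    rw [him, he]
    congr 2
    push_cast
    ring
  have hmix (f : ℝ →ᵇ NNReal) (ε : NNReal) (hε : 0 < ε) :
      ∫⁻ x, ∫⁻ u, f u ∂cauchyMeasure x ε ∂α = ∫⁻ u, f u ∂cauchyMeasure a (b + ε) := by
    have hf : Measurable fun u => (f u : ℝ≥0∞) :=
      measurable_coe_nnreal_ennreal.comp f.continuous.measurable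
    have hjoint : Measurable fun p : ℝ × ℝ => cauchyPDF p.1 ε p.2 := by
      unfold cauchyPDF cauchyPDFReal
      fun_prop
    have hε' : b + ε ≠ 0 := (hε.trans_le le_add_self).ne'
    rw [cauchyMeasure_of_scale_ne_zero _ hε',
      lintegral_withDensity_eq_lintegral_mul _ (measurable_cauchyPDF _ _) hf]
    simp_rw [cauchyMeasure_of_scale_ne_zero _ hε.ne',
      lintegral_withDensity_eq_lintegral_mul _ (measurable_cauchyPDF _ _) hf, Pi.mul_apply]
    rw [lintegral_lintegral_swap (hjoint.mul (hf.comp measurable_snd)).aemeasurable]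
    refine lintegral_congr fun u => ?_
    rw [lintegral_mul_const' _ _ ENNReal.coe_ne_top, hdens ε hε]
  -- Let `ε → 0` in `hmix`: the smoothing kernel collapses to a Dirac mass and the left side tends
  -- to `∫ f dα`.
  refine ext_of_forall_lintegral_eq_of_IsFiniteMeasure fun f => ?_
  have hf : Measurable fun u => (f u : ℝ≥0∞) :=
    measurable_coe_nnreal_ennreal.comp f.continuous.measurable
  set ε : ℕ → NNReal := fun n => 1 / ((n : NNReal) + 1) with hεdef
  have hεpos (n : ℕ) : 0 < ε n := by positivity
  have hε : Tendsto ε atTop (𝓝 0) := tendsto_one_div_add_atTop_nhds_zero_nat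
  have h1 : Tendsto (fun n => ∫⁻ x, ∫⁻ u, f u ∂cauchyMeasure x (ε n) ∂α) atTop
      (𝓝 (∫⁻ x, ∫⁻ u, f u ∂cauchyMeasure x 0 ∂α)) := by
    refine tendsto_lintegral_of_dominated_convergence (fun _ => (nndist f 0 : ℝ≥0∞))
      (fun n => ?_) (fun n => ae_of_all _ fun x => ?_) (by simp)
      (ae_of_all _ fun x => tendsto_lintegral_cauchyMeasure f x hε)
    · simp_rw [lintegral_cauchyMeasure _ _ hf]
      exact Measurable.lintegral_prod_right' (f := fun p : ℝ × ℝ => (f (p.1 + ε n * p.2) : ℝ≥0∞))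
        (hf.comp (by fun_prop))
    · calc ∫⁻ u, f u ∂cauchyMeasure x (ε n)
          ≤ ∫⁻ _, (nndist f 0 : ℝ≥0∞) ∂cauchyMeasure x (ε n) :=
            lintegral_mono fun u => ENNReal.coe_le_coe.2 (BoundedContinuousFunction.NNReal.upper_bound f u)
        _ = (nndist f 0 : ℝ≥0∞) := by simp
  have h2 : Tendsto (fun n => ∫⁻ x, ∫⁻ u, f u ∂cauchyMeasure x (ε n) ∂α) atTop
      (𝓝 (∫⁻ u, f u ∂cauchyMeasure a b)) := by
    simp_rw [fun n => hmix f (ε n) (hεpos n)]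
    refine tendsto_lintegral_cauchyMeasure f a ?_
    simpa using hε.const_add b
  have := tendsto_nhds_unique h1 h2
  simpa using this

/-! ### Solving the two-cycle -/

theorem norm_stieltjesTransform_le (μ : Measure ℝ) [IsProbabilityMeasure μ] {z : ℂ}
    (hz : 0 < z.im) : ‖stieltjesTransform μ z‖ ≤ z.im⁻¹ := by
  rw [stieltjesTransform_eq_inv]
  simpa using norm_integral_le_of_norm_le_const (μ := μ)
    (ae_of_all _ (norm_ofReal_sub_inv_le hz))

theorem stieltjesTransform_im_pos (μ : Measure ℝ) [IsProbabilityMeasure μ] {z : ℂ}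
    (hz : 0 < z.im) : 0 < (stieltjesTransform μ z).im := by
  have hi := integrable_ofReal_sub_inv μ hz
  have him := integral_im hi
  simp only [RCLike.im_to_complex] at him
  rw [stieltjesTransform_eq_inv, ← him]
  have hpos (x : ℝ) : 0 < (((x : ℂ) - z)⁻¹).im := by
    rw [Complex.inv_im]
    have := Complex.normSq_pos.2 (ofReal_sub_ne_zero hz x)
    simp only [Complex.sub_im, Complex.ofReal_im, zero_sub, neg_neg]
    positivity
  rw [integral_pos_iff_support_of_nonneg (fun x => (hpos x).le) hi.im]
  have : Function.support (fun x : ℝ => (((x : ℂ) - z)⁻¹).im) = univ :=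
    eq_univ_of_forall fun x => (hpos x).ne'
  rw [this]
  simp

theorem exists_eq_of_hasDerivAt_zero_upperHalfPlane {f : ℂ → ℂ}
    (hf : ∀ z : ℂ, 0 < z.im → HasDerivAt f 0 z) : ∃ c, ∀ z : ℂ, 0 < z.im → f z = c := by
  have hopen : IsOpen {z : ℂ | 0 < z.im} := isOpen_lt continuous_const Complex.continuous_im
  have hconv : Convex ℝ {z : ℂ | 0 < z.im} := convex_halfSpace_im_gt 0
  refine ⟨f Complex.I, fun z hz => ?_⟩
  exact hopen.is_const_of_deriv_eq_zero hconv.isPreconnected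
    (fun w hw => (hf w hw).differentiableAt.differentiableWithinAt)
    (fun w hw => (hf w hw).deriv) hz (show (0 : ℝ) < Complex.I.im by simp)

theorem stieltjesTransform_eq_of_cyclic {μ ν : Measure ℝ} [IsProbabilityMeasure μ]
    [IsProbabilityMeasure ν]
    (hμ : ∀ z : ℂ, 0 < z.im → HasDerivAt (stieltjesTransform μ)
      (stieltjesTransform ν z * stieltjesTransform μ z) z)
    (hν : ∀ z : ℂ, 0 < z.im → HasDerivAt (stieltjesTransform ν)
      (stieltjesTransform μ z * stieltjesTransform ν z) z) {z : ℂ} (hz : 0 < z.im) :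
    stieltjesTransform μ z = stieltjesTransform ν z := by
  obtain ⟨c, hc⟩ := exists_eq_of_hasDerivAt_zero_upperHalfPlane
    (f := fun z => stieltjesTransform μ z - stieltjesTransform ν z) fun z hz => by
      exact ((hμ z hz).sub (hν z hz)).congr_deriv (by ring)
  have hle (t : ℝ) (ht : 0 < t) : ‖c‖ ≤ 2 * t⁻¹ := by
    have him : (0 : ℝ) < (t * Complex.I).im := by simpa using ht
    rw [← hc (t * Complex.I) him]
    refine (norm_sub_le _ _).trans ?_
    have h1 := norm_stieltjesTransform_le μ him
    have h2 := norm_stieltjesTransform_le ν him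
    simp only [Complex.mul_im, Complex.ofReal_re, Complex.I_im, mul_one, Complex.ofReal_im,
      Complex.I_re, mul_zero, add_zero] at h1 h2
    linarith
  have hlim : Tendsto (fun t : ℝ => 2 * t⁻¹) atTop (𝓝 0) := by
    simpa using tendsto_inv_atTop_zero.const_mul (2 : ℝ)
  have hc0 : ‖c‖ ≤ 0 := ge_of_tendsto hlim (by
    filter_upwards [eventually_gt_atTop 0] with t ht using hle t ht)
  have := hc z hz
  rw [norm_le_zero_iff.1 hc0] at this
  exact sub_eq_zero.1 this

theorem exists_eq_cauchyMeasure_of_hasDerivAt {α : Measure ℝ} [IsProbabilityMeasure α]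
    (hα : ∀ z : ℂ, 0 < z.im →
      HasDerivAt (stieltjesTransform α) (stieltjesTransform α z ^ 2) z) :
    ∃ (a : ℝ) (b : NNReal), α = cauchyMeasure a b := by
  have hne (z : ℂ) (hz : 0 < z.im) : stieltjesTransform α z ≠ 0 := fun h => by
    simpa [h] using stieltjesTransform_im_pos α hz
  -- Separation of variables: `y' = y²` makes `1/y + z` constant, and `y` has no zeros because its
  -- imaginary part is positive.
  obtain ⟨c, hc⟩ := exists_eq_of_hasDerivAt_zero_upperHalfPlane
    (f := fun z => (stieltjesTransform α z)⁻¹ + z) fun z hz => by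
      have := ((hα z hz).fun_inv (hne z hz)).add (hasDerivAt_id z)
      exact this.congr_deriv (by rw [neg_div, div_self (pow_ne_zero 2 (hne z hz)), neg_add_cancel])
  have heq (z : ℂ) (hz : 0 < z.im) : stieltjesTransform α z = (c - z)⁻¹ := by
    rw [← hc z hz, add_sub_cancel_right, inv_inv]
  -- Positivity of `Im y` at `z = it` keeps the pole `c` below `it` for every `t > 0`.
  have hlt (t : ℝ) (ht : 0 < t) : c.im < t := by
    have him : (0 : ℝ) < (t * Complex.I).im := by simpa using ht
    have h := stieltjesTransform_im_pos α him
    rw [heq _ him, Complex.inv_im] at h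
    by_contra! hle
    refine h.not_ge (div_nonpos_of_nonpos_of_nonneg ?_ (Complex.normSq_nonneg _))
    simpa using hle
  have hc0 : c.im ≤ 0 := le_of_forall_gt_imp_ge_of_dense fun t ht => (hlt t ht).le
  refine ⟨c.re, ⟨-c.im, by linarith⟩, eq_cauchyMeasure_of_integral_inv fun z hz =>
    ⟨integrable_ofReal_sub_inv α hz, ?_⟩⟩
  rw [← stieltjesTransform_eq_inv, heq z hz]
  congr 2
  apply Complex.ext
  · simp
  · simp only [Complex.sub_im, Complex.ofReal_im, Complex.mul_im, Complex.I_im, Complex.I_re,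
      Complex.ofReal_re, mul_one, mul_zero, add_zero, zero_sub]
    exact (neg_neg _).symm

theorem proposition6p7 (α : Measure ℝ) (n : ℕ) (hn : 2 ≤ n)
    (hFT : ∀ k < n, IsFT1 (dirichletIter α k))
    (hcycle : dirichletIter α n = α) :
    (∀ z : ℂ, 0 < z.im →
      HasDerivAt (stieltjesTransform (dirichletIter α 1))
        (stieltjesTransform (dirichletIter α n) z *
          stieltjesTransform (dirichletIter α 1) z) z ∧
      ∀ j : ℕ, 1 ≤ j → j + 1 ≤ n →
        HasDerivAt (stieltjesTransform (dirichletIter α (j + 1)))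
          (stieltjesTransform (dirichletIter α j) z *
            stieltjesTransform (dirichletIter α (j + 1)) z) z) ∧
    (n = 2 →
      (∃ (a : ℝ) (b : NNReal), 0 < b ∧ α = cauchyMeasure a b) ∨
        ∃ a : ℝ, α = Measure.dirac a) := by
  have hα : IsFT1 α := hFT 0 (by omega)
  have hstep (j : ℕ) (hj : j < n) (z : ℂ) (hz : 0 < z.im) :
      HasDerivAt (stieltjesTransform (dirichletIter α (j + 1)))
        (stieltjesTransform (dirichletIter α j) z *
          stieltjesTransform (dirichletIter α (j + 1)) z) z :=
    hasDerivAt_stieltjesTransform_dirichletMean (hFT j hj) hz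
  have hfirst (z : ℂ) (hz : 0 < z.im) : HasDerivAt (stieltjesTransform (dirichletIter α 1))
      (stieltjesTransform α z * stieltjesTransform (dirichletIter α 1) z) z :=
    hstep 0 (by omega) z hz
  refine ⟨fun z hz => ⟨?_, fun j _ hj => hstep j hj z hz⟩, ?_⟩
  · rw [hcycle]
    exact hfirst z hz
  · rintro rfl
    have := hα.isProbabilityMeasure
    have := (hFT 1 one_lt_two).isProbabilityMeasure
    have hsecond (z : ℂ) (hz : 0 < z.im) : HasDerivAt (stieltjesTransform α)
        (stieltjesTransform (dirichletIter α 1) z * stieltjesTransform α z) z := by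
      have h := hstep 1 one_lt_two z hz
      rwa [one_add_one_eq_two, hcycle] at h
    obtain ⟨a, b, hab⟩ := exists_eq_cauchyMeasure_of_hasDerivAt (α := α) fun z hz => by
      have h := hsecond z hz
      rwa [stieltjesTransform_eq_of_cyclic hfirst hsecond hz, ← sq] at h
    -- The Cauchy measure of scale 0 is by convention the Dirac mass.
    rcases eq_or_ne b 0 with rfl | hb
    · exact Or.inr ⟨a, by simpa using hab⟩
    · exact Or.inl ⟨a, b, pos_iff_ne_zero.2 hb, hab⟩
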